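/- All graphs are finite and simple. For a graph $G$ with vertex set $V(G)$, let $\mathcal S(G)$ be the set of real symmetric matrices $A=[a_{ij}]$ with rows and columns indexed by $V(G)$ such that, for all $i\neq j$, $a_{ij}\neq 0$ if and only if $ij\in E(G)$; the diagonal entries are unrestricted. Let $\operatorname{M}(G)=\max\{\operatorname{null}(A) : A\in\mathcal S(G)\}$. A matrix $A\in\mathcal S(G)$ has the Strong Arnold Property (SAP) if there is no nonzero real symmetric matrix $X$ with $AX=0$, $A\circ X=0$ and $I\circ X=0$, where $\circ$ is the entrywise product. Let $\xi(G)=\max\{\operatorname{null}(A) : A\in\mathcal S(G)\text{ and } A \text{ has the SAP}\}$. Color the vertices of a subset of $V(G)$ blue and all other vertices white. The color change rule says that a blue vertex can change a white vertex $w$ to blue if $w$ is the only white vertex adjacent to it. The subset is a zero forcing set if all vertices are blue after the rule has been applied until no more changes are possible, and $\operatorname{Z}(G)$ is the minimum cardinality of a zero forcing set of $G$. A graph $H$ is a minor of $G$ if, up to isomorphism, $H$ can be constructed from $G$ by a finite (possibly empty) sequence of edge deletions, vertex deletions and contractions of edges. Here contracting an edge $v_1v_2$ means deleting $v_1$ and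 $v_2$ and inserting a new vertex adjacent to exactly those remaining vertices that were adjacent to $v_1$ or to $v_2$. A minor $H$ of $G$ is a zero forcing minor of $G$ if $\operatorname{Z}(G)\le\operatorname{Z}(H)$. **Theorem.** Let $H$ be a zero forcing minor of $G$ such that $\xi(H)=\operatorname{Z}(H)$. Then $$\xi(G)=\operatorname{M}(G)=\operatorname{Z}(G)=\operatorname{Z}(H).$$ -/

import Mathlib

namespace ZeroForcing

universe u v

/-! ### Matrices of a graph, maximum nullity and the parameter `ξ` -/

/-- `𝒮(G)`: the real symmetric matrices whose off-diagonal nonzero pattern is that of the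
adjacency matrix of `G`; the diagonal entries are free. -/
def symmMatrices {V : Type u} (G : SimpleGraph V) : Set (Matrix V V ℝ) :=
  {A | A.IsSymm ∧ ∀ i j, i ≠ j → (A i j ≠ 0 ↔ G.Adj i j)}

/-- The nullity of a square real matrix: the dimension of its kernel. For a symmetric matrix this
is the multiplicity of `0` as an eigenvalue. -/
noncomputable def nullity {V : Type u} [Fintype V] (A : Matrix V V ℝ) : ℕ :=
  Module.finrank ℝ (LinearMap.ker A.mulVecLin)

/-- The Strong Arnold Property: no nonzero symmetric `X` satisfies `A X = 0`, `A ∘ X = 0` and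
`I ∘ X = 0`, where `∘` is the entrywise product. -/
def HasSAP {V : Type u} [Fintype V] (A : Matrix V V ℝ) : Prop :=
  ¬ ∃ X : Matrix V V ℝ, X ≠ 0 ∧ X.IsSymm ∧ A * X = 0 ∧ (∀ i j, A i j * X i j = 0) ∧
    ∀ i, X i i = 0

/-- The nullity of an `n × n` matrix is at most `n`, so the suprema below are maxima. -/
theorem nullity_le_card {V : Type u} [Fintype V] (A : Matrix V V ℝ) :
    nullity A ≤ Fintype.card V := by
  simpa [nullity] using Submodule.finrank_le (LinearMap.ker A.mulVecLin)

/-- The maximum nullity `M(G)` (over the real field). -/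
noncomputable def maxNullity {V : Type u} [Fintype V] (G : SimpleGraph V) : ℕ :=
  sSup {k | ∃ A ∈ symmMatrices G, nullity A = k}

/-- The Colin de Verdière type parameter `ξ(G)`: the maximum nullity over the matrices in `𝒮(G)`
that have the Strong Arnold Property. -/
noncomputable def xi {V : Type u} [Fintype V] (G : SimpleGraph V) : ℕ :=
  sSup {k | ∃ A ∈ symmMatrices G, HasSAP A ∧ nullity A = k}

/-! ### Zero forcing -/

/-- One application of the color change rule: with `B` the set of blue vertices, a blue vertex `b`
forces the white vertex `w`, the only white vertex adjacent to `b`. -/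
def Force {V : Type u} (G : SimpleGraph V) (B B' : Set V) : Prop :=
  ∃ b ∈ B, ∃ w ∉ B, G.Adj b w ∧ (∀ x, x ∉ B → G.Adj b x → x = w) ∧ B' = insert w B

/-- `S` is a zero forcing set: starting from `S` blue, a chronological list of forces colors all
vertices blue. -/
def IsZeroForcingSet {V : Type u} (G : SimpleGraph V) (S : Set V) : Prop :=
  Relation.ReflTransGen (Force G) S Set.univ

/-- The zero forcing number `Z(G)`: the minimum cardinality of a zero forcing set. -/
noncomputable def zeroForcingNumber {V : Type u} [Fintype V] (G : SimpleGraph V) : ℕ :=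
  sInf {k | ∃ S : Finset V, IsZeroForcingSet G (S : Set V) ∧ S.card = k}

/-! ### Minors -/

/-- The graph obtained from `G` by deleting the vertices `a` and `b` and inserting a new vertex
(`none`) adjacent to exactly those remaining vertices that were adjacent to `a` or to `b`. -/
def contract {V : Type u} (G : SimpleGraph V) (a b : V) :
    SimpleGraph (Option {w : V // w ≠ a ∧ w ≠ b}) where
  Adj
    | none, none => False
    | none, some w => G.Adj w a ∨ G.Adj w b
    | some w, none => G.Adj w a ∨ G.Adj w b
    | some w, some w' => G.Adj w w'
  symm := ⟨by
    rintro (_ | x) (_ | y) h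
    · exact h
    · exact h
    · exact h
    · exact G.adj_symm h⟩
  loopless := ⟨by
    rintro (_ | x) h
    · exact h
    · exact G.irrefl h⟩

/-- The graphs that are constructed from `G` by a finite sequence of edge deletions, vertex
deletions and edge contractions. -/
inductive Constructible {V : Type u} (G : SimpleGraph V) :
    ∀ {W : Type u}, SimpleGraph W → Prop
  | refl : Constructible G G
  | deleteEdge {W : Type u} {K : SimpleGraph W} (h : Constructible G K) (e : Sym2 W)
      (he : e ∈ K.edgeSet) : Constructible G (K.deleteEdges {e})
  | deleteVertex {W : Type u} {K : SimpleGraph W} (h : Constructible G K) (x : W) :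
      Constructible G (K.induce {y | y ≠ x})
  | contractEdge {W : Type u} {K : SimpleGraph W} (h : Constructible G K) (a b : W)
      (hab : K.Adj a b) : Constructible G (contract K a b)

/-- `H` is a minor of `G`: up to isomorphism, `H` can be constructed from `G` by edge deletions,
vertex deletions and edge contractions. -/
def IsMinor {W : Type v} {V : Type u} (H : SimpleGraph W) (G : SimpleGraph V) : Prop :=
  ∃ (U : Type u) (K : SimpleGraph U), Constructible G K ∧ Nonempty (K ≃g H)

/-- `H` is a zero forcing minor of `G`: `H` is a minor of `G` and `Z(G) ≤ Z(H)`. -/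
def IsZeroForcingMinor {W : Type v} {V : Type u} [Fintype W] [Fintype V]
    (H : SimpleGraph W) (G : SimpleGraph V) : Prop :=
  IsMinor H G ∧ zeroForcingNumber G ≤ zeroForcingNumber H

end ZeroForcing

/-!
The theorem follows from the chain
`Z(H) = ξ(H) ≤ ξ(G) ≤ M(G) ≤ Z(G) ≤ Z(H)`.

`M(G) ≤ Z(G)`: a kernel vector of a matrix in `𝒮(G)` that vanishes on a zero forcing set vanishes
everywhere (`IsZeroForcingSet.eq_zero`), so restriction to the set is injective on the kernel.

`ξ(H) ≤ ξ(G)` is the minor monotonicity of `ξ` (`IsMinor.xi_le`). By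
`HasSAP.functional_eq_zero`, the Strong Arnold Property of `A ∈ 𝒮(K)` says that the space of
symmetric matrices with the pattern of `K` is transversal to the orbit of `A` under congruence
`A ↦ TᵀAT`, along which the nullity is constant. A surjective strict derivative makes a map open, so
if `C + s • R C` is a small perturbation of the family `C ∈ 𝒮(K)`, then for some small `s ≠ 0` there
is a `C` near `A` with `C + s • R C` congruent to `A` (`HasSAP.exists_perturbation`). The Strong
Arnold Property itself is an injectivity condition and hence stable (`HasSAP.exists_stable`).
Two choices of `R` suffice:

* for a supergraph of `K` on the same vertices, `R` puts weights on the new edges (`XiLE.of_le`);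
* for a contraction of `ab`, regarded as the graph `merge G a b` in which `b` is isolated, `R`
  couples `b` to its former neighbours. For `s ≠ 0` the change of coordinates
  `x_b = x_a + s z`, where `z` is the coordinate of the isolated vertex, turns `C + s • R C` into a
  matrix of `G` (`exists_of_merge`).

Adding isolated vertices with diagonal entry `1` is harmless (`exists_extension`), which reduces
vertex deletions and contractions to graphs on one vertex set.
-/

open Matrix Filter Topology

namespace ZeroForcing

/-! ### Maximum nullity is at most the zero forcing number -/

/-- If the blue vertex `b` forces `w`, then row `b` of `A v = 0` reads `A b w * v w = 0`. -/
theorem Force.vanish {V : Type*} [Fintype V] {G : SimpleGraph V} {A : Matrix V V ℝ}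
    (hA : A ∈ symmMatrices G) {v : V → ℝ} (hv : A *ᵥ v = 0) {B B' : Set V}
    (h : Force G B B') (hB : ∀ i ∈ B, v i = 0) : ∀ i ∈ B', v i = 0 := by
  classical
  obtain ⟨b, hb, w, hw, hbw, huniq, rfl⟩ := h
  have hsum : ∑ j, A b j * v j = A b w * v w := by
    refine Finset.sum_eq_single w (fun j _ hj => ?_) (fun h => absurd (Finset.mem_univ w) h)
    by_cases hjB : j ∈ B
    · rw [hB j hjB, mul_zero]
    · have hbj : b ≠ j := fun h => hjB (h ▸ hb)
      have : A b j = 0 := by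
        by_contra h0
        exact hj (huniq j hjB (((hA.2 b j hbj)).1 h0))
      rw [this, zero_mul]
  have h0 : A b w * v w = 0 := by rw [← hsum]; exact congrFun hv b
  have hAbw : A b w ≠ 0 := (hA.2 b w hbw.ne).2 hbw
  rintro i (rfl | hi)
  · exact (mul_eq_zero.1 h0).resolve_left hAbw
  · exact hB i hi

theorem IsZeroForcingSet.eq_zero {V : Type*} [Fintype V] {G : SimpleGraph V} {A : Matrix V V ℝ}
    (hA : A ∈ symmMatrices G) {v : V → ℝ} (hv : A *ᵥ v = 0) {S : Set V}
    (hS : IsZeroForcingSet G S) (h : ∀ i ∈ S, v i = 0) : v = 0 := by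
  have key : ∀ T, Relation.ReflTransGen (Force G) S T → ∀ i ∈ T, v i = 0 := by
    intro T hT
    induction hT with
    | refl => exact h
    | tail _ hf ih => exact hf.vanish hA hv ih
  exact funext fun i => key _ hS i trivial

theorem IsZeroForcingSet.nullity_le {V : Type*} [Fintype V] {G : SimpleGraph V}
    {A : Matrix V V ℝ} (hA : A ∈ symmMatrices G) {S : Finset V}
    (hS : IsZeroForcingSet G (S : Set V)) : nullity A ≤ S.card := by
  let r : LinearMap.ker A.mulVecLin →ₗ[ℝ] (S → ℝ) :=
    (LinearMap.funLeft ℝ ℝ (Subtype.val : S → V)).comp (Submodule.subtype _)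
  have hr : Function.Injective r := by
    rw [← LinearMap.ker_eq_bot, LinearMap.ker_eq_bot']
    rintro ⟨v, hv⟩ h
    refine Subtype.ext (hS.eq_zero hA (v := v) (by simpa using hv) fun i hi => ?_)
    exact congrFun h ⟨i, hi⟩
  simpa [nullity] using LinearMap.finrank_le_finrank_of_injective hr

theorem maxNullity_le_zeroForcingNumber {V : Type*} [Fintype V] (G : SimpleGraph V) :
    maxNullity G ≤ zeroForcingNumber G := by
  have hne : {k | ∃ S : Finset V, IsZeroForcingSet G (S : Set V) ∧ S.card = k}.Nonempty :=
    ⟨_, Finset.univ, by simpa [IsZeroForcingSet] using Relation.ReflTransGen.refl, rfl⟩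
  obtain ⟨S, hS, hcard⟩ := Nat.sInf_mem hne
  refine csSup_le' ?_
  rintro k ⟨A, hA, rfl⟩
  rw [zeroForcingNumber, ← hcard]
  exact hS.nullity_le hA

theorem bddAbove_nullity {V : Type*} [Fintype V] (P : Matrix V V ℝ → Prop) :
    BddAbove {k | ∃ A, P A ∧ nullity A = k} :=
  ⟨Fintype.card V, by rintro k ⟨A, -, rfl⟩; exact nullity_le_card A⟩

theorem xi_le_maxNullity {V : Type*} [Fintype V] (G : SimpleGraph V) : xi G ≤ maxNullity G := by
  refine csSup_le' ?_
  rintro k ⟨A, hA, -, rfl⟩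
  exact le_csSup (bddAbove_nullity (· ∈ symmMatrices G)) ⟨A, hA, rfl⟩

/-! ### Graphs whose Strong Arnold matrices transfer -/

/-- `XiLE H G`: every matrix of `H` with the Strong Arnold Property is matched by such a matrix of
`G` of at least the same nullity. Unlike `ξ(H) ≤ ξ(G)`, it needs no maximum to be attained. -/
def XiLE {W V : Type*} [Fintype W] [Fintype V] (H : SimpleGraph W) (G : SimpleGraph V) : Prop :=
  ∀ A ∈ symmMatrices H, HasSAP A → ∃ B ∈ symmMatrices G, HasSAP B ∧ nullity A ≤ nullity B

theorem XiLE.trans {U W V : Type*} [Fintype U] [Fintype W] [Fintype V] {K : SimpleGraph U}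
    {H : SimpleGraph W} {G : SimpleGraph V} (h₁ : XiLE K H) (h₂ : XiLE H G) : XiLE K G := by
  intro A hA hs
  obtain ⟨B, hB, hsB, hAB⟩ := h₁ A hA hs
  obtain ⟨C, hC, hsC, hBC⟩ := h₂ B hB hsB
  exact ⟨C, hC, hsC, hAB.trans hBC⟩

theorem XiLE.xi_le {W V : Type*} [Fintype W] [Fintype V] {H : SimpleGraph W} {G : SimpleGraph V}
    (h : XiLE H G) : xi H ≤ xi G := by
  refine csSup_le' ?_
  rintro k ⟨A, hA, hs, rfl⟩
  obtain ⟨B, hB, hsB, hAB⟩ := h A hA hs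
  refine hAB.trans (le_csSup ?_ ⟨B, hB, hsB, rfl⟩)
  exact ⟨Fintype.card V, by rintro k ⟨A, -, -, rfl⟩; exact nullity_le_card A⟩

theorem hasSAP_iff {V : Type*} [Fintype V] {G : SimpleGraph V} {A : Matrix V V ℝ}
    (hA : A ∈ symmMatrices G) :
    HasSAP A ↔ ∀ X : Matrix V V ℝ, X.IsSymm → A * X = 0 → (∀ i, X i i = 0) →
      (∀ i j, G.Adj i j → X i j = 0) → X = 0 := by
  constructor
  · intro h X hX hAX hd he
    by_contra hne
    refine h ⟨X, hne, hX, hAX, fun i j => ?_, hd⟩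
    by_cases hij : i = j
    · rw [hij, hd, mul_zero]
    · by_cases hadj : G.Adj i j
      · rw [he i j hadj, mul_zero]
      · rw [not_not.1 (mt (hA.2 i j hij).1 hadj), zero_mul]
  · rintro h ⟨X, hne, hX, hAX, hc, hd⟩
    exact hne (h X hX hAX hd fun i j hij =>
      (mul_eq_zero.1 (hc i j)).resolve_left ((hA.2 i j hij.ne).2 hij))

/-! ### Adding isolated vertices -/

/-- The direct sum of a matrix of `H` with an identity block, along an embedding of `H` into a
graph in which all other vertices are isolated. -/
theorem exists_extension {W V : Type*} [Fintype W] [Fintype V] {H : SimpleGraph W}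
    {K : SimpleGraph V} (f : H ↪g K) (hK : ∀ i j, K.Adj i j → i ∈ Set.range f)
    {A : Matrix W W ℝ} (hA : A ∈ symmMatrices H) (hs : HasSAP A) :
    ∃ B ∈ symmMatrices K, HasSAP B ∧ nullity A ≤ nullity B ∧ ∀ i ∉ Set.range f, B i i = 1 := by
  classical
  let F : Matrix V W ℝ := Matrix.of fun i w => if i = f w then 1 else 0
  let D : Matrix V V ℝ := Matrix.diagonal fun i => if i ∈ Set.range f then 0 else 1
  have hFF : Fᵀ * F = 1 := by
    ext w w'
    simp [F, Matrix.mul_apply, Matrix.one_apply, f.injective.eq_iff, eq_comm]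
  have hDF : D * F = 0 := by
    ext i w
    simp only [D, F, Matrix.diagonal_mul, Matrix.of_apply, Matrix.zero_apply]
    split_ifs <;> simp_all
  have hFD : Fᵀ * D = 0 := by
    have := congrArg Matrix.transpose hDF
    simpa [D, Matrix.transpose_mul] using this
  have hDD : D * D = D := by
    simp only [D, Matrix.diagonal_mul_diagonal]
    congr 1; ext i; split_ifs <;> simp
  let B : Matrix V V ℝ := F * A * Fᵀ + D
  have hBf : ∀ w w', B (f w) (f w') = A w w' := by
    intro w w'
    simp [B, F, D, Matrix.mul_apply, f.injective.eq_iff, Matrix.diagonal_apply]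
  have hBn : ∀ i j, i ∉ Set.range f → B i j = if i = j then 1 else 0 := by
    intro i j hi
    have : ∀ w, i ≠ f w := fun w h => hi ⟨w, h.symm⟩
    have hD : D i j = if i = j then 1 else 0 := by
      simp only [D, Matrix.diagonal_apply, if_neg hi]
    simp [B, F, Matrix.mul_apply, this, hD]
  have hBs : B.IsSymm := by
    simp [Matrix.IsSymm, B, D, Matrix.transpose_mul, Matrix.mul_assoc, hA.1.eq]
  have hBK : B ∈ symmMatrices K := by
    refine ⟨hBs, fun i j hij => ?_⟩
    by_cases hi : i ∈ Set.range f
    · by_cases hj : j ∈ Set.range f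
      · obtain ⟨w, rfl⟩ := hi
        obtain ⟨w', rfl⟩ := hj
        rw [hBf, f.map_adj_iff]
        exact hA.2 w w' fun h => hij (h ▸ rfl)
      · rw [← hBs.apply, hBn j i hj, if_neg hij.symm]
        simpa using fun h => hj (hK _ _ (K.adj_symm h))
    · rw [hBn i j hi, if_neg hij]
      simpa using fun h => hi (hK _ _ h)
  refine ⟨B, hBK, (hasSAP_iff hBK).2 fun X hX hBX hd he => ?_, ?_, fun i hi => by simp [hBn i i hi]⟩
  · have hDX : D * X = 0 := by
      have : D * (B * X) = D * X := by
        rw [← Matrix.mul_assoc, Matrix.mul_add, hDD, ← Matrix.mul_assoc, ← Matrix.mul_assoc, hDF]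
        simp
      rw [← this, hBX, Matrix.mul_zero]
    have hrow : ∀ i ∉ Set.range f, ∀ j, X i j = 0 := by
      intro i hi j
      have := congrFun (congrFun hDX i) j
      simp only [D, Matrix.diagonal_mul, if_neg hi, one_mul] at this
      exact this
    have hAX : A * (Fᵀ * X) = 0 := by
      have : Fᵀ * (B * X) = A * (Fᵀ * X) := by
        rw [← Matrix.mul_assoc, Matrix.mul_add, hFD, ← Matrix.mul_assoc, ← Matrix.mul_assoc, hFF]
        simp [Matrix.mul_assoc]
      rw [← this, hBX, Matrix.mul_zero]
    have hent : ∀ w w', (Fᵀ * X * F) w w' = X (f w) (f w') := by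
      intro w w'
      simp [F, Matrix.mul_apply]
    have hY : Fᵀ * X * F = 0 := by
      refine (hasSAP_iff hA).1 hs _ ?_ ?_ (fun w => ?_) (fun w w' h => ?_)
      · simp [Matrix.IsSymm, Matrix.transpose_mul, Matrix.mul_assoc, hX.eq]
      · rw [← Matrix.mul_assoc, hAX, Matrix.zero_mul]
      · rw [hent, hd]
      · rw [hent, he _ _ (f.map_adj_iff.2 h)]
    ext i j
    by_cases hi : i ∈ Set.range f
    · by_cases hj : j ∈ Set.range f
      · obtain ⟨w, rfl⟩ := hi
        obtain ⟨w', rfl⟩ := hj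
        rw [← hent, hY]; rfl
      · rw [← hX.apply, hrow j hj]; rfl
    · exact hrow i hi j
  · have hBF : B * F = F * A := by
      rw [Matrix.add_mul, hDF, Matrix.mul_assoc, hFF]; simp
    have hmem : ∀ v ∈ LinearMap.ker A.mulVecLin, F.mulVecLin v ∈ LinearMap.ker B.mulVecLin := by
      intro v hv
      simp only [LinearMap.mem_ker, Matrix.mulVecLin_apply] at hv ⊢
      rw [Matrix.mulVec_mulVec, hBF, ← Matrix.mulVec_mulVec, hv, Matrix.mulVec_zero]
    refine LinearMap.finrank_le_finrank_of_injective (f := F.mulVecLin.restrict hmem) ?_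
    intro u v h
    have h' : F *ᵥ u.1 = F *ᵥ v.1 := congrArg Subtype.val h
    have := congrArg (Fᵀ *ᵥ ·) h'
    simp only [Matrix.mulVec_mulVec, hFF, Matrix.one_mulVec] at this
    exact Subtype.ext this

/-! ### Perturbing a matrix with the Strong Arnold Property -/

section Perturbation

attribute [local instance] Matrix.linftyOpNormedRing Matrix.linftyOpNormedAlgebra

variable {V : Type*}

/-- The linear map from all matrices onto the symmetric matrices that vanish outside the diagonal
and the edges of `K`: symmetrize, then set the other entries to zero. -/
noncomputable def patternMap (K : SimpleGraph V) : Matrix V V ℝ →ₗ[ℝ] Matrix V V ℝ := by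
  classical exact
  { toFun := fun p => Matrix.of fun i j => if i = j ∨ K.Adj i j then p i j + p j i else 0
    map_add' := fun p q => by
      ext i j
      by_cases hij : i = j ∨ K.Adj i j <;> simp [hij]
      ring
    map_smul' := fun r p => by
      ext i j
      by_cases hij : i = j ∨ K.Adj i j <;> simp [hij]
      ring }

theorem patternMap_apply_of (K : SimpleGraph V) (p : Matrix V V ℝ) {i j : V}
    (h : i = j ∨ K.Adj i j) : patternMap K p i j = p i j + p j i := by
  simp [patternMap, h]

theorem patternMap_apply_of_not (K : SimpleGraph V) (p : Matrix V V ℝ) {i j : V}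
    (h : ¬ (i = j ∨ K.Adj i j)) : patternMap K p i j = 0 := by
  simp [patternMap, h]

theorem patternMap_isSymm (K : SimpleGraph V) (p : Matrix V V ℝ) : (patternMap K p).IsSymm := by
  ext i j
  rw [Matrix.transpose_apply]
  by_cases h : i = j ∨ K.Adj i j
  · rw [patternMap_apply_of K p h, patternMap_apply_of K p (h.imp Eq.symm K.adj_symm), add_comm]
  · rw [patternMap_apply_of_not K p h,
      patternMap_apply_of_not K p (fun h' => h (h'.imp Eq.symm K.adj_symm))]

variable [Fintype V] [DecidableEq V]

theorem abs_entry_le_norm (Y : Matrix V V ℝ) (i j : V) : |Y i j| ≤ ‖Y‖ := by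
  rw [Matrix.linfty_opNorm_def]
  have h1 : ‖Y i j‖₊ ≤ ∑ j, ‖Y i j‖₊ :=
    Finset.single_le_sum (f := fun j => ‖Y i j‖₊) (fun _ _ => zero_le) (Finset.mem_univ j)
  have h2 : ∑ j, ‖Y i j‖₊ ≤ Finset.univ.sup fun i => ∑ j, ‖Y i j‖₊ :=
    Finset.le_sup (f := fun i => ∑ j, ‖Y i j‖₊) (Finset.mem_univ i)
  exact_mod_cast h1.trans h2

/-- The Strong Arnold Property is stable: it survives a small change of the matrix, even if the
vanishing of `Y` on the edges is only required up to a small relative error. The reason is that an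
injective linear map on a finite-dimensional space is bounded below. -/
theorem HasSAP.exists_stable {K : SimpleGraph V} {A : Matrix V V ℝ} (hA : A ∈ symmMatrices K)
    (h : HasSAP A) : ∃ c > 0, ∀ B Y : Matrix V V ℝ, ‖B - A‖ < c → Y.IsSymm → B * Y = 0 →
      (∀ i, Y i i = 0) → (∀ i j, K.Adj i j → |Y i j| ≤ c * ‖Y‖) → Y = 0 := by
  classical
  let L : Matrix V V ℝ →ₗ[ℝ] Matrix V V ℝ × Matrix V V ℝ × (V → V → ℝ) :=
    { toFun := fun Y => (Y - Yᵀ, A * Y, fun i j => if i = j ∨ K.Adj i j then Y i j else 0)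
      map_add' := fun Y Z => by
        refine Prod.ext ?_ (Prod.ext ?_ ?_)
        · simp only [Matrix.transpose_add, Prod.fst_add]; abel
        · simp [Matrix.mul_add]
        · funext i j
          by_cases hij : i = j ∨ K.Adj i j <;> simp [hij]
      map_smul' := fun r Y => by
        refine Prod.ext ?_ (Prod.ext ?_ ?_)
        · simp [smul_sub]
        · simp
        · funext i j
          by_cases hij : i = j ∨ K.Adj i j <;> simp [hij] }
  have hL : LinearMap.ker L = ⊥ := by
    refine LinearMap.ker_eq_bot'.2 fun Y hY => ?_
    have h1 : Y - Yᵀ = 0 := congrArg Prod.fst hY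
    have h2 : A * Y = 0 := congrArg (fun x => x.2.1) hY
    have h3 : ∀ i j, (if i = j ∨ K.Adj i j then Y i j else 0) = 0 := fun i j =>
      congrFun (congrFun (congrArg (fun x => x.2.2) hY) i) j
    refine (hasSAP_iff hA).1 h Y (sub_eq_zero.1 h1).symm h2 (fun i => ?_) fun i j hij => ?_
    · simpa using h3 i i
    · simpa [hij] using h3 i j
  obtain ⟨M, hM, hanti⟩ := L.exists_antilipschitzWith hL
  have hM' : (0 : ℝ) < M := hM
  refine ⟨1 / (2 * M), by positivity, fun B Y hB hYs hBY hd he => ?_⟩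
  set c : ℝ := 1 / (2 * M) with hc
  have hc0 : 0 < c := by positivity
  have hbound : ‖Y‖ ≤ M * ‖L Y‖ := by simpa using hanti.le_mul_norm_sub (x := Y) (y := 0)
  have hLY : ‖L Y‖ ≤ c * ‖Y‖ := by
    have hnn : 0 ≤ c * ‖Y‖ := by positivity
    have h1 : ‖Y - Yᵀ‖ ≤ c * ‖Y‖ := by rw [hYs.eq, sub_self, norm_zero]; exact hnn
    have h2 : ‖A * Y‖ ≤ c * ‖Y‖ := by
      have : A * Y = -((B - A) * Y) := by rw [Matrix.sub_mul, hBY]; simp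
      rw [this, norm_neg]
      exact (norm_mul_le _ _).trans (mul_le_mul_of_nonneg_right hB.le (norm_nonneg _))
    have h3 : ‖fun i j => if i = j ∨ K.Adj i j then Y i j else 0‖ ≤ c * ‖Y‖ := by
      refine (pi_norm_le_iff_of_nonneg hnn).2 fun i => (pi_norm_le_iff_of_nonneg hnn).2 fun j => ?_
      by_cases hij : i = j
      · subst hij; simpa [hd] using hnn
      · by_cases hadj : K.Adj i j
        · simpa [hadj] using he i j hadj
        · simpa [hij, hadj] using hnn
    exact max_le h1 (max_le h2 h3)
  have hhalf : ‖Y‖ ≤ ‖Y‖ / 2 := by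
    calc ‖Y‖ ≤ M * (c * ‖Y‖) := hbound.trans (mul_le_mul_of_nonneg_left hLY hM'.le)
      _ = ‖Y‖ / 2 := by rw [hc]; field_simp
  exact norm_le_zero_iff.1 (by linarith)

/-- The Strong Arnold Property says that the pattern space of `K` and the tangent space
`{TᵀA + AT}` of the congruence orbit of `A` together span the symmetric matrices; with the
skew-symmetric matrices `S - Sᵀ` they span all matrices. -/
theorem HasSAP.functional_eq_zero {K : SimpleGraph V} {A : Matrix V V ℝ}
    (hA : A ∈ symmMatrices K) (h : HasSAP A) (φ : Matrix V V ℝ →ₗ[ℝ] ℝ)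
    (hp : ∀ p, φ (patternMap K p) = 0) (hT : ∀ T, φ (Tᵀ * A + A * T) = 0)
    (hS : ∀ S, φ (S - Sᵀ) = 0) : φ = 0 := by
  let Y : Matrix V V ℝ := Matrix.of fun i j => φ (Matrix.single i j 1)
  have hφ : ∀ R, φ R = ∑ i, ∑ j, R i j * Y i j := by
    intro R
    conv_lhs => rw [Matrix.matrix_eq_sum_single R]
    simp only [map_sum]
    refine Finset.sum_congr rfl fun i _ => Finset.sum_congr rfl fun j _ => ?_
    have : Matrix.single i j (R i j) = R i j • Matrix.single i j (1 : ℝ) := by simp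
    rw [this, map_smul, smul_eq_mul]; rfl
  have hYs : Y.IsSymm := by
    ext i j
    have := hS (Matrix.single i j 1)
    rw [Matrix.transpose_single, map_sub, sub_eq_zero] at this
    exact this.symm
  have hYe : ∀ i j, i = j ∨ K.Adj i j → Y i j = 0 := by
    intro i j hij
    have h1 : patternMap K (Matrix.single i j 1) = Matrix.single i j 1 + Matrix.single j i 1 := by
      ext k l
      by_cases hkl : k = l ∨ K.Adj k l
      · rw [patternMap_apply_of _ _ hkl, Matrix.add_apply]
        simp only [Matrix.single_apply]
        congr 1
        simp only [and_comm]
      · rw [patternMap_apply_of_not _ _ hkl, Matrix.add_apply]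
        have h2 : ¬ (i = k ∧ j = l) := by rintro ⟨rfl, rfl⟩; exact hkl hij
        have h3 : ¬ (j = k ∧ i = l) := by
          rintro ⟨rfl, rfl⟩; exact hkl (hij.imp Eq.symm K.adj_symm)
        simp [h2, h3]
    have h2 := hp (Matrix.single i j 1)
    rw [h1, map_add] at h2
    have h3 : Y i j + Y j i = 0 := h2
    rw [hYs.apply i j] at h3
    linarith
  have hAY : A * Y = 0 := by
    ext k l
    have hsum : ∀ R, φ Rᵀ = φ R := fun R => by
      have := hS R
      rw [map_sub, sub_eq_zero] at this
      exact this.symm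
    have h1 := hT (Matrix.single k l 1)
    have h2 : (Matrix.single k l (1 : ℝ))ᵀ * A = (A * Matrix.single k l 1)ᵀ := by
      rw [Matrix.transpose_mul, hA.1.eq]
    rw [h2, map_add, hsum] at h1
    have h3 : φ (A * Matrix.single k l 1) = 0 := by linarith
    rw [hφ] at h3
    have h4 : ∀ i j, (A * Matrix.single k l (1 : ℝ)) i j = if j = l then A i k else 0 := by
      intro i j
      by_cases hjl : j = l
      · subst hjl; simp
      · simp [hjl]
    simp only [h4, ite_mul, zero_mul, Finset.sum_ite_eq', Finset.mem_univ, if_true] at h3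
    rw [Matrix.mul_apply, Matrix.zero_apply, ← h3]
    exact Finset.sum_congr rfl fun i _ => by rw [hA.1.apply]
  have hY : Y = 0 := (hasSAP_iff hA).1 h Y hYs hAY (fun i => hYe i i (Or.inl rfl))
    fun i j hij => hYe i j (Or.inr hij)
  ext R
  simp [hφ, hY]

theorem nullity_congr_of_isUnit (A T : Matrix V V ℝ) (hT : IsUnit T.det) :
    nullity (Tᵀ * A * T) = nullity A := by
  have h1 : (Tᵀ * A * T).rank = A.rank := by
    rw [Matrix.rank_mul_eq_left_of_isUnit_det _ _ hT,
      Matrix.rank_mul_eq_right_of_isUnit_det _ _ (by rwa [Matrix.det_transpose])]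
  have h2 := LinearMap.finrank_range_add_finrank_ker (Tᵀ * A * T).mulVecLin
  have h3 := LinearMap.finrank_range_add_finrank_ker A.mulVecLin
  unfold nullity
  unfold Matrix.rank at h1
  omega

/-- A matrix with the Strong Arnold Property can be moved, within the matrices of `K`, so as to
compensate a small perturbation `s • R C` without losing nullity: by transversality, the open
mapping form of the implicit function theorem finds `C` near `A`, for some arbitrarily small
`s ≠ 0`, such that `C + s • R C` is congruent to `A`. -/
theorem HasSAP.exists_perturbation {K : SimpleGraph V} {A : Matrix V V ℝ}
    (hA : A ∈ symmMatrices K) (h : HasSAP A) {R : Matrix V V ℝ → Matrix V V ℝ}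
    {R' : Matrix V V ℝ →L[ℝ] Matrix V V ℝ} (hR : HasStrictFDerivAt R R' A)
    (hRs : ∀ C : Matrix V V ℝ, C.IsSymm → (R C).IsSymm)
    {Q : ℝ → Matrix V V ℝ → Prop} (hQ : ∀ᶠ x : ℝ × Matrix V V ℝ in 𝓝 (0, A), Q x.1 x.2) :
    ∃ s C, s ≠ 0 ∧ C ∈ symmMatrices K ∧ Q s C ∧ nullity (C + s • R C) = nullity A := by
  classical
  -- The unknowns `(s, p, T, S)`: the size of the perturbation, the change of `C` within the pattern
  -- of `K`, the congruence by `1 + T`, and a skew-symmetric term `S - Sᵀ` that lets all matrices,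
  -- and not only the symmetric ones, be the target space.
  let E := ℝ × Matrix V V ℝ × Matrix V V ℝ × Matrix V V ℝ
  let π₁ : E →L[ℝ] ℝ := ContinuousLinearMap.fst ℝ _ _
  let π' : E →L[ℝ] Matrix V V ℝ × Matrix V V ℝ × Matrix V V ℝ := ContinuousLinearMap.snd ℝ _ _
  let π₂ : E →L[ℝ] Matrix V V ℝ := (ContinuousLinearMap.fst ℝ _ _).comp π'
  let π₃ : E →L[ℝ] Matrix V V ℝ :=
    (ContinuousLinearMap.fst ℝ _ _).comp ((ContinuousLinearMap.snd ℝ _ _).comp π')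
  let π₄ : E →L[ℝ] Matrix V V ℝ :=
    (ContinuousLinearMap.snd ℝ _ _).comp ((ContinuousLinearMap.snd ℝ _ _).comp π')
  let ψ : Matrix V V ℝ →L[ℝ] Matrix V V ℝ := (patternMap K).toContinuousLinearMap
  let τ : Matrix V V ℝ →L[ℝ] Matrix V V ℝ :=
    (Matrix.transposeLinearEquiv V V ℝ ℝ).toLinearMap.toContinuousLinearMap
  have hψ : ∀ p, ψ p = patternMap K p := fun p => rfl
  have hτ : ∀ p, τ p = pᵀ := fun p => rfl
  let C : E → Matrix V V ℝ := fun x => A + (ψ.comp π₂) x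
  have hC0 : C 0 = A := by simp [C]
  have hC : HasStrictFDerivAt C (ψ.comp π₂) 0 := (ψ.comp π₂).hasStrictFDerivAt.const_add A
  have hRC : HasStrictFDerivAt (fun x => R (C x)) (R'.comp (ψ.comp π₂)) 0 :=
    HasStrictFDerivAt.comp (0 : E) (by rw [hC0]; exact hR) hC
  have hsR : HasStrictFDerivAt (fun x => π₁ x • R (C x)) _ 0 :=
    π₁.hasStrictFDerivAt.fun_smul hRC
  have hT : HasStrictFDerivAt (fun x : E => 1 + π₃ x) π₃ 0 := π₃.hasStrictFDerivAt.const_add 1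
  have hTt : HasStrictFDerivAt (fun x : E => 1 + (τ.comp π₃) x) (τ.comp π₃) 0 :=
    (τ.comp π₃).hasStrictFDerivAt.const_add 1
  have hTAT : HasStrictFDerivAt (fun x : E => ((1 + (τ.comp π₃) x) * A) * (1 + π₃ x)) _ 0 :=
    (hTt.mul_const' A).mul' hT
  have hK : HasStrictFDerivAt (fun x : E => (π₄ - τ.comp π₄) x) (π₄ - τ.comp π₄) 0 :=
    (π₄ - τ.comp π₄).hasStrictFDerivAt
  let g : E → ℝ × Matrix V V ℝ := fun x =>
    (π₁ x, C x + π₁ x • R (C x) - ((1 + (τ.comp π₃) x) * A) * (1 + π₃ x) + (π₄ - τ.comp π₄) x)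
  obtain ⟨g', hg, hg'⟩ : ∃ g' : E →L[ℝ] ℝ × Matrix V V ℝ, HasStrictFDerivAt g g' 0 ∧
      ∀ x : E, g' x = (x.1, (patternMap K x.2.1 + x.1 • R A)
        - (x.2.2.1ᵀ * A + A * x.2.2.1) + (x.2.2.2 - x.2.2.2ᵀ)) := by
    refine ⟨_, π₁.hasStrictFDerivAt.prodMk (((hC.add hsR).sub hTAT).add hK), fun x => ?_⟩
    refine Prod.ext rfl ?_
    change patternMap K x.2.1 + ((0 : ℝ) • R' (ψ x.2.1) + x.1 • R (C 0))
      - ((1 + (0 : Matrix V V ℝ)ᵀ) * A * x.2.2.1 + x.2.2.1ᵀ * A * (1 + 0))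
      + (x.2.2.2 - x.2.2.2ᵀ) = _
    rw [hC0]
    simp only [zero_smul, zero_add, Matrix.transpose_zero, add_zero, Matrix.one_mul, Matrix.mul_one]
    abel
  have hg0 : g 0 = (0, 0) := by simp [g, C]
  have hsurj : LinearMap.range g'.toLinearMap = ⊤ := by
    by_contra hne
    obtain ⟨φ, hφ0, hφ⟩ := Submodule.exists_le_ker_of_lt_top _ (lt_top_iff_ne_top.2 hne)
    have hφx : ∀ x : E, φ (x.1, (patternMap K x.2.1 + x.1 • R A)
        - (x.2.2.1ᵀ * A + A * x.2.2.1) + (x.2.2.2 - x.2.2.2ᵀ)) = 0 := by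
      intro x
      rw [← hg']
      exact hφ ⟨x, rfl⟩
    have h0 : φ.comp (LinearMap.inr ℝ ℝ (Matrix V V ℝ)) = 0 := by
      refine h.functional_eq_zero hA _ (fun p => ?_) (fun T => ?_) fun S => ?_
      · simpa using hφx (0, p, 0, 0)
      · have h1 := hφx (0, 0, -T, 0)
        have h2 : (patternMap K 0 + (0 : ℝ) • R A) - ((-T)ᵀ * A + A * -T)
            + ((0 : Matrix V V ℝ) - 0ᵀ) = Tᵀ * A + A * T := by
          simp; abel
        rw [h2] at h1
        exact h1
      · simpa using hφx (0, 0, 0, S)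
    have h1 : ∀ M, φ (0, M) = 0 := fun M => LinearMap.congr_fun h0 M
    refine hφ0 (LinearMap.ext fun y => ?_)
    have h2 := hφx (y.1, 0, 0, 0)
    have h3 := h1 (y.2 - y.1 • R A)
    have h4 := congrArg₂ (· + ·) h2 h3
    simp only [← map_add] at h4
    simpa using h4
  have hnhds := hg.map_nhds_eq_of_surj hsurj
  rw [hg0] at hnhds
  have hCt : Tendsto (fun x : E => (π₁ x, C x)) (𝓝 0) (𝓝 (0, A)) := by
    have h1 : ContinuousAt (fun x : E => (π₁ x, C x)) 0 :=
      π₁.continuous.continuousAt.prodMk hC.continuousAt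
    simpa [ContinuousAt, hC0] using h1
  have hdet : ∀ᶠ x : E in 𝓝 0, (1 + π₃ x).det ≠ 0 := by
    have h1 : ContinuousAt (fun x : E => (1 + π₃ x).det) 0 := by
      refine Continuous.continuousAt ?_
      exact (continuous_const.add π₃.continuous).matrix_det
    exact h1.eventually_ne (by simp)
  have hpat : ∀ᶠ x : E in 𝓝 0, ∀ i j, K.Adj i j → C x i j ≠ 0 := by
    refine eventually_all.2 fun i => eventually_all.2 fun j => ?_
    by_cases hij : K.Adj i j
    · have h1 : ContinuousAt (fun x : E => C x i j) 0 :=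
        (continuous_apply_apply i j).continuousAt.comp hC.continuousAt
      filter_upwards [h1.eventually_ne (y := 0) (by rw [hC0]; exact (hA.2 i j hij.ne).2 hij)]
        with x hx _ using hx
    · exact Eventually.of_forall fun x h => absurd h hij
  have hev : g '' {x | Q (π₁ x) (C x) ∧ (1 + π₃ x).det ≠ 0 ∧ ∀ i j, K.Adj i j → C x i j ≠ 0}
      ∈ map g (𝓝 0) := image_mem_map ((hCt.eventually hQ).and (hdet.and hpat))
  have hline : Tendsto (fun s : ℝ => (s, (0 : Matrix V V ℝ))) (𝓝[≠] 0) (𝓝 (0, 0)) :=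
    ((Continuous.prodMk continuous_id continuous_const).tendsto' (0 : ℝ) _ rfl).mono_left
      nhdsWithin_le_nhds
  obtain ⟨s, ⟨x, ⟨hQx, hdx, hpx⟩, hgx⟩, hs⟩ :=
    (((hline.mono_right hnhds.ge).eventually hev).and self_mem_nhdsWithin).exists
  have hs1 : π₁ x = s := congrArg Prod.fst hgx
  have hs2 : C x + π₁ x • R (C x) - ((1 + (τ.comp π₃) x) * A) * (1 + π₃ x)
      + (π₄ - τ.comp π₄) x = 0 := congrArg Prod.snd hgx
  rw [hs1] at hs2 hQx
  have hCs : (C x).IsSymm := hA.1.add (patternMap_isSymm K _)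
  have hCK : C x ∈ symmMatrices K := by
    refine ⟨hCs, fun i j hij => ⟨fun hne => ?_, hpx i j⟩⟩
    by_contra hadj
    refine hne ?_
    have h1 : A i j = 0 := not_not.1 (mt (hA.2 i j hij).1 hadj)
    have h2 : patternMap K (π₂ x) i j = 0 := patternMap_apply_of_not K _ (by tauto)
    change A i j + patternMap K (π₂ x) i j = 0
    rw [h1, h2, add_zero]
  refine ⟨s, C x, hs, hCK, hQx, ?_⟩
  have hTx : 1 + (τ.comp π₃) x = (1 + π₃ x)ᵀ := by
    rw [Matrix.transpose_add, Matrix.transpose_one]; rfl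
  rw [hTx] at hs2
  -- The equation splits into a symmetric and a skew-symmetric part, so both vanish.
  have hsym : (C x + s • R (C x) - (1 + π₃ x)ᵀ * A * (1 + π₃ x)).IsSymm := by
    refine (hCs.add ((hRs _ hCs).smul s)).sub ?_
    simp [Matrix.IsSymm, Matrix.transpose_mul, Matrix.mul_assoc, hA.1.eq]
  have hskew : ((π₄ - τ.comp π₄) x)ᵀ = -(π₄ - τ.comp π₄) x := by
    change (π₄ x - (π₄ x)ᵀ)ᵀ = -(π₄ x - (π₄ x)ᵀ)
    simp
  have hzero : C x + s • R (C x) - (1 + π₃ x)ᵀ * A * (1 + π₃ x) = 0 := by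
    have h1 := congrArg Matrix.transpose hs2
    rw [Matrix.transpose_add, hsym.eq, hskew, Matrix.transpose_zero] at h1
    have h2 : (2 : ℝ) • (C x + s • R (C x) - (1 + π₃ x)ᵀ * A * (1 + π₃ x)) = 0 := by
      have h3 := congrArg₂ (· + ·) hs2 h1
      simp only [add_zero] at h3
      rw [two_smul, ← h3]
      abel
    exact (smul_eq_zero.1 h2).resolve_left two_ne_zero
  rw [sub_eq_zero.1 hzero]
  exact nullity_congr_of_isUnit A _ (isUnit_iff_ne_zero.2 hdx)

end Perturbation

section SameVertexSet

attribute [local instance] Matrix.linftyOpNormedRing Matrix.linftyOpNormedAlgebra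

/-! ### Adding edges -/

/-- The new edges receive a common small weight `s ≠ 0`. -/
theorem XiLE.of_le {V : Type*} [Fintype V] {K G : SimpleGraph V} (hKG : K ≤ G) : XiLE K G := by
  classical
  intro A hA hs
  obtain ⟨c, hc, hstab⟩ := hs.exists_stable hA
  let N : Matrix V V ℝ := Matrix.of fun i j => if G.Adj i j ∧ ¬ K.Adj i j then 1 else 0
  have hN : N.IsSymm := by
    ext i j
    simp [N, G.adj_comm i j, K.adj_comm i j]
  have hQ : ∀ᶠ x : ℝ × Matrix V V ℝ in 𝓝 (0, A), ‖x.2 + x.1 • N - A‖ < c := by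
    have h1 : Continuous fun x : ℝ × Matrix V V ℝ => ‖x.2 + x.1 • N - A‖ :=
      ((continuous_snd.add (continuous_fst.smul continuous_const)).sub continuous_const).norm
    exact h1.continuousAt.eventually_lt continuousAt_const (by simpa using hc)
  obtain ⟨s, C, hs0, hC, hnear, hnull⟩ := hs.exists_perturbation hA
    (R := fun _ => N) (hasStrictFDerivAt_const N A) (fun _ _ => hN)
    (Q := fun s C => ‖C + s • N - A‖ < c) hQ
  have hB : C + s • N ∈ symmMatrices G := by
    refine ⟨hC.1.add (hN.smul s), fun i j hij => ?_⟩
    simp only [Matrix.add_apply, Matrix.smul_apply, smul_eq_mul]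
    have h1 := hC.2 i j hij
    by_cases hK : K.Adj i j
    · have h2 := h1.2 hK
      simpa [N, hK, hKG hK] using h2
    · have h2 : C i j = 0 := not_not.1 (mt h1.1 hK)
      by_cases hG : G.Adj i j <;> simp [N, hK, hG, h2, hs0]
  refine ⟨_, hB, (hasSAP_iff hB).2 fun X hX hBX hd he => ?_, hnull.ge⟩
  refine hstab _ X hnear hX hBX hd fun i j hij => ?_
  rw [he i j (hKG hij), abs_zero]
  positivity

/-! ### Contracting an edge -/

/-- The contraction of `ab` modelled on the original vertex set: `a` takes over the neighbours of
`b`, and `b` becomes isolated. -/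
def merge {V : Type*} (G : SimpleGraph V) (a b : V) : SimpleGraph V where
  Adj i j := i ≠ j ∧ i ≠ b ∧ j ≠ b ∧ (G.Adj i j ∨ (i = a ∧ G.Adj b j) ∨ (j = a ∧ G.Adj b i))
  symm := ⟨by
    rintro i j ⟨hij, hi, hj, h⟩
    refine ⟨hij.symm, hj, hi, ?_⟩
    rw [G.adj_comm j i]
    tauto⟩
  loopless := ⟨fun _ h => h.1 rfl⟩

/-- The embedding of the contracted graph that sends the new vertex to `a`. -/
def contractEmbedding {V : Type*} (G : SimpleGraph V) {a b : V} (hab : a ≠ b) :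
    contract G a b ↪g merge G a b where
  toFun
    | none => a
    | some w => w
  inj' := by
    rintro (_ | ⟨x, hx⟩) (_ | ⟨y, hy⟩) h
    · rfl
    · exact absurd h.symm hy.1
    · exact absurd h hx.1
    · exact congrArg some (Subtype.ext h)
  map_rel_iff' := by
    rintro (_ | ⟨x, hx⟩) (_ | ⟨y, hy⟩)
    · exact iff_of_false (SimpleGraph.irrefl _) (SimpleGraph.irrefl _)
    · change (merge G a b).Adj a y ↔ G.Adj y a ∨ G.Adj y b
      simp [merge, hy, hy.1.symm, hab, G.adj_comm y]
    · change (merge G a b).Adj x a ↔ G.Adj x a ∨ G.Adj x b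
      simp [merge, hx, hab, G.adj_comm x]
    · change (merge G a b).Adj x y ↔ G.Adj x y
      simp only [merge, hx.1, hx.2, hy.1, hy.2, ne_eq, not_false_eq_true, false_and, or_false,
        true_and]
      exact ⟨fun h => h.2, fun h => ⟨h.ne, h⟩⟩

/-- Undoing a contraction. The new coordinate is `x_b - x_a` divided by a small `s`: a quadratic
form of `G` with weight about `1 / s²` on `(x_b - x_a)²` tends, in these coordinates, to a form of
`merge G a b`. -/
theorem exists_of_merge {V : Type*} [Fintype V] {G : SimpleGraph V} {a b : V} (hab : G.Adj a b)
    {A : Matrix V V ℝ} (hA : A ∈ symmMatrices (merge G a b)) (hs : HasSAP A) (hbb : A b b ≠ 0) :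
    ∃ B ∈ symmMatrices G, HasSAP B ∧ nullity A ≤ nullity B := by
  classical
  have hne : a ≠ b := hab.ne
  obtain ⟨c, hc, hstab⟩ := hs.exists_stable hA
  -- `θ w` is the share of the weight of the merged edge `aw` that goes to the edge `bw`.
  let θ : V → ℝ := fun w =>
    if w = a ∨ w = b then 0 else if G.Adj b w then (if G.Adj a w then 1 / 2 else 1) else 0
  let ρ : Matrix V V ℝ →ₗ[ℝ] Matrix V V ℝ :=
    (LinearMap.mulLeft ℝ (Matrix.single b a (1 : ℝ))).comp
      (LinearMap.mulRight ℝ (Matrix.diagonal θ))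
  let R : Matrix V V ℝ →ₗ[ℝ] Matrix V V ℝ :=
    ρ + (Matrix.transposeLinearEquiv V V ℝ ℝ).toLinearMap.comp ρ
  have hRdef : ∀ C, R C = ρ C + (ρ C)ᵀ := fun _ => rfl
  have hρ : ∀ C i j, ρ C i j = if i = b then C a j * θ j else 0 := by
    intro C i j
    change (Matrix.single b a (1 : ℝ) * (C * Matrix.diagonal θ)) i j = _
    by_cases hi : i = b
    · subst hi; simp
    · simp [hi]
  have hRs : ∀ C, (R C).IsSymm := fun C => by
    rw [hRdef, Matrix.IsSymm, Matrix.transpose_add, Matrix.transpose_transpose, add_comm]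
  have hQ : ∀ᶠ x : ℝ × Matrix V V ℝ in 𝓝 (0, A),
      ‖x.2 + x.1 • R x.2 - A‖ < c ∧ |x.1| < c ∧ x.2 b b ≠ 0 := by
    have hRc : Continuous R := R.continuous_of_finiteDimensional
    have h1 : Continuous fun x : ℝ × Matrix V V ℝ => ‖x.2 + x.1 • R x.2 - A‖ :=
      ((continuous_snd.add (continuous_fst.smul (hRc.comp continuous_snd))).sub
        continuous_const).norm
    have h2 : Continuous fun x : ℝ × Matrix V V ℝ => |x.1| := continuous_fst.abs
    have h3 : Continuous fun x : ℝ × Matrix V V ℝ => x.2 b b :=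
      (continuous_apply_apply b b).comp continuous_snd
    refine (h1.continuousAt.eventually_lt continuousAt_const (by simpa using hc)).and
      ((h2.continuousAt.eventually_lt continuousAt_const (by simpa using hc)).and
        (h3.continuousAt.eventually_ne hbb))
  obtain ⟨s, C, hs0, hC, ⟨hnear, hsc, hCbb⟩, hnull⟩ := hs.exists_perturbation hA
    (R := R) (R' := R.toContinuousLinearMap) R.toContinuousLinearMap.hasStrictFDerivAt
    (fun C _ => hRs C)
    (Q := fun s C => ‖C + s • R C - A‖ < c ∧ |s| < c ∧ C b b ≠ 0) hQ
  set Φ : Matrix V V ℝ := C + s • R C with hΦ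
  have hΦs : Φ.IsSymm := hC.1.add ((hRs C).smul s)
  have hΦij : ∀ i j, i ≠ b → j ≠ b → Φ i j = C i j := by
    intro i j hi hj
    simp [hΦ, hRdef, hρ, hi, hj]
  have hΦbj : ∀ j, j ≠ b → Φ b j = s * (C a j * θ j) := by
    intro j hj
    have : C b j = 0 := not_not.1 (mt (hC.2 b j hj.symm).1 fun h => h.2.1 rfl)
    simp [hΦ, hRdef, hρ, hj, this]
  have hΦbb : Φ b b = C b b := by
    have : θ b = 0 := by simp [θ]
    simp [hΦ, hRdef, hρ, this]
  -- The change of coordinates back to `x_a`, `x_b`.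
  let d : V → ℝ := Function.update 1 b s⁻¹
  have hdb : d b = s⁻¹ := by simp [d]
  have hd : ∀ i, i ≠ b → d i = 1 := fun i hi => by simp [d, hi]
  let T : Matrix V V ℝ := Matrix.diagonal d * Matrix.transvection b a (-1)
  have hTdet : IsUnit T.det := by
    refine isUnit_iff_ne_zero.2 ?_
    rw [Matrix.det_mul, Matrix.det_transvection_of_ne _ _ hne.symm, mul_one, Matrix.det_diagonal]
    refine Finset.prod_ne_zero_iff.2 fun i _ => ?_
    by_cases hi : i = b
    · rw [hi, hdb]; exact inv_ne_zero hs0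
    · rw [hd i hi]; exact one_ne_zero
  have hMT : ∀ (M : Matrix V V ℝ) i j,
      (M * T) i j = M i j * d j - if j = a then M i b * s⁻¹ else 0 := by
    intro M i j
    simp only [T, ← Matrix.mul_assoc]
    by_cases hj : j = a
    · subst hj
      rw [Matrix.mul_transvection_apply_same, Matrix.mul_diagonal, Matrix.mul_diagonal, hdb]
      simp; ring
    · rw [Matrix.mul_transvection_apply_of_ne _ _ _ _ hj, Matrix.mul_diagonal]
      simp [hj]
  have hTM : ∀ (M : Matrix V V ℝ) i j,
      (Tᵀ * M) i j = d i * M i j - if i = a then s⁻¹ * M b j else 0 := by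
    intro M i j
    have h1 : Tᵀ * M = (Mᵀ * T)ᵀ := by rw [Matrix.transpose_mul Mᵀ T, Matrix.transpose_transpose]
    rw [h1, Matrix.transpose_apply, hMT]
    simp [mul_comm]
  have hTX : ∀ (M : Matrix V V ℝ) i j,
      (T * M) i j = d i * (M i j - if i = b then M a j else 0) := by
    intro M i j
    simp only [T, Matrix.mul_assoc, Matrix.diagonal_mul]
    by_cases hi : i = b
    · subst hi
      rw [Matrix.transvection_mul_apply_same, if_pos rfl]
      ring
    · rw [Matrix.transvection_mul_apply_of_ne _ _ _ _ hi]
      simp [hi]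
  have hXT : ∀ (M : Matrix V V ℝ) i j,
      (M * Tᵀ) i j = d j * (M i j - if j = b then M i a else 0) := by
    intro M i j
    have h1 : M * Tᵀ = (T * Mᵀ)ᵀ := by rw [Matrix.transpose_mul T Mᵀ, Matrix.transpose_transpose]
    rw [h1, Matrix.transpose_apply, hTX]
    simp
  set B : Matrix V V ℝ := Tᵀ * Φ * T with hBdef
  have hBs : B.IsSymm := by
    simp [Matrix.IsSymm, hBdef, Matrix.transpose_mul, Matrix.mul_assoc, hΦs.eq]
  have hBij : ∀ i j, i ≠ a → i ≠ b → j ≠ a → j ≠ b → B i j = C i j := by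
    intro i j hia hib hja hjb
    rw [hBdef, hMT, hTM]
    simp [hia, hja, hd i hib, hd j hjb, hΦij i j hib hjb]
  have hBaj : ∀ j, j ≠ a → j ≠ b → B a j = C a j * (1 - θ j) := by
    intro j hja hjb
    rw [hBdef, hMT, hTM]
    simp only [hja, hd j hjb, hd a hne, hΦij a j hne hjb, hΦbj j hjb, if_true, if_false]
    field_simp
    ring
  have hBbj : ∀ j, j ≠ a → j ≠ b → B b j = C a j * θ j := by
    intro j hja hjb
    rw [hBdef, hMT, hTM]
    simp only [hja, hd j hjb, hdb, hΦbj j hjb, hne.symm, if_false]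
    field_simp
    ring
  have hBab : B a b ≠ 0 := by
    have hθ : θ a = 0 := by simp [θ]
    have h1 : Φ a b = 0 := by rw [← hΦs.apply, hΦbj a hne, hθ]; simp
    rw [hBdef, hMT, hTM]
    simp [hdb, h1, hne.symm, hΦbb, hs0, hCbb]
  have hBG : B ∈ symmMatrices G := by
    have haj : ∀ j, j ≠ a → j ≠ b → (B a j ≠ 0 ↔ G.Adj a j) := by
      intro j hja hjb
      have h1 := hC.2 a j hja.symm
      have h2 : (merge G a b).Adj a j ↔ G.Adj a j ∨ G.Adj b j := by
        simp [merge, hja, hja.symm, hjb, hne]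
      rw [h2] at h1
      rw [hBaj j hja hjb, mul_ne_zero_iff, h1]
      by_cases h3 : G.Adj a j <;> by_cases h4 : G.Adj b j <;> simp [θ, hja, hjb, h3, h4]
      norm_num
    have hbj : ∀ j, j ≠ a → j ≠ b → (B b j ≠ 0 ↔ G.Adj b j) := by
      intro j hja hjb
      have h1 := hC.2 a j hja.symm
      have h2 : (merge G a b).Adj a j ↔ G.Adj a j ∨ G.Adj b j := by
        simp [merge, hja, hja.symm, hjb, hne]
      rw [h2] at h1
      rw [hBbj j hja hjb, mul_ne_zero_iff, h1]
      by_cases h3 : G.Adj a j <;> by_cases h4 : G.Adj b j <;> simp [θ, hja, hjb, h3, h4]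
    refine ⟨hBs, fun i j hij => ?_⟩
    by_cases hia : i = a
    · subst hia
      by_cases hjb : j = b
      · subst hjb; simp [hBab, hab]
      · exact haj j hij.symm hjb
    by_cases hib : i = b
    · subst hib
      by_cases hja : j = a
      · subst hja; rw [hBs.apply]; simp [hBab, hab.symm]
      · exact hbj j hja hij.symm
    rw [← hBs.apply, G.adj_comm]
    by_cases hja : j = a
    · subst hja; exact haj i hia hib
    by_cases hjb : j = b
    · subst hjb; exact hbj i hia hib
    rw [hBij j i hja hjb hia hib, hC.2 j i hij.symm]
    simp [merge, hia, hib, hja, hjb, hij.symm]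
  refine ⟨B, hBG, (hasSAP_iff hBG).2 fun X hX hBX hXd hXe => ?_, ?_⟩
  · have hTu : IsUnit T := (Matrix.isUnit_iff_isUnit_det T).2 hTdet
    have hTtu : IsUnit Tᵀ :=
      (Matrix.isUnit_iff_isUnit_det _).2 (by rwa [Matrix.det_transpose])
    set Y : Matrix V V ℝ := T * (X * Tᵀ) with hY
    have hYs : Y.IsSymm := by
      simp [Matrix.IsSymm, hY, Matrix.transpose_mul, Matrix.mul_assoc, hX.eq]
    have hΦY : Φ * Y = 0 := by
      have h1 : Tᵀ * (Φ * Y) = 0 := by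
        have : Tᵀ * (Φ * Y) = B * X * Tᵀ := by simp only [hY, hBdef, Matrix.mul_assoc]
        rw [this, hBX, Matrix.zero_mul]
      exact hTtu.mul_right_eq_zero.1 h1
    have hYij : ∀ i j, i ≠ b → j ≠ b → Y i j = X i j := by
      intro i j hi hj
      rw [hY, hTX, hXT]
      simp [hi, hj, hd]
    have hYbj : ∀ j, j ≠ b → Y b j = s⁻¹ * (X b j - X a j) := by
      intro j hj
      rw [hY, hTX, hXT, hXT]
      simp [hj, hd, hdb]
    have hYbb : Y b b = 0 := by
      rw [hY, hTX, hXT, hXT]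
      simp [hXd, hXe a b hab, hXe b a hab.symm]
    -- On an edge inherited from `b` alone, `Y` is not zero but of the order of `s`.
    have key : ∀ j, j ≠ b → G.Adj b j → |Y a j| ≤ c * ‖Y‖ := by
      intro j hj hbj
      have h1 : Y a j = -s * Y b j := by
        rw [hYij a j hne hj, hYbj j hj, hXe b j hbj]
        field_simp
        ring
      rw [h1, abs_mul, abs_neg]
      exact mul_le_mul hsc.le (abs_entry_le_norm Y b j) (abs_nonneg _) hc.le
    have hY0 : Y = 0 := by
      refine hstab Φ Y hnear hYs hΦY (fun i => ?_) fun i j hij => ?_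
      · by_cases hi : i = b
        · rw [hi, hYbb]
        · rw [hYij i i hi hi, hXd]
      · obtain ⟨hij, hi, hj, h | ⟨rfl, h⟩ | ⟨rfl, h⟩⟩ := hij
        · rw [hYij i j hi hj, hXe i j h, abs_zero]; positivity
        · exact key j hj h
        · rw [← hYs.apply]; exact key i hi h
    rw [hY] at hY0
    exact hTtu.mul_left_eq_zero.1 (hTu.mul_right_eq_zero.1 hY0)
  · rw [hBdef, nullity_congr_of_isUnit Φ T hTdet, hnull]

end SameVertexSet

theorem XiLE.contract {V : Type*} [Fintype V] (G : SimpleGraph V) {a b : V} (hab : G.Adj a b)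
    [Fintype (Option {w : V // w ≠ a ∧ w ≠ b})] : XiLE (contract G a b) G := by
  intro A hA hs
  have hrange : ∀ i, i ∈ Set.range (contractEmbedding G hab.ne) ↔ i ≠ b := by
    intro i
    constructor
    · rintro ⟨_ | ⟨x, hx⟩, rfl⟩
      · exact hab.ne
      · exact hx.2
    · intro hi
      by_cases hia : i = a
      · exact ⟨none, hia.symm⟩
      · exact ⟨some ⟨i, hia, hi⟩, rfl⟩
  obtain ⟨B, hB, hsB, hAB, hdiag⟩ := exists_extension (contractEmbedding G hab.ne)
    (fun i j h => (hrange i).2 h.2.1) hA hs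
  have hbb : B b b = 1 := hdiag b fun h => (hrange b).1 h rfl
  obtain ⟨D, hD, hsD, hBD⟩ := exists_of_merge hab hB hsB (by rw [hbb]; exact one_ne_zero)
  exact ⟨D, hD, hsD, hAB.trans hBD⟩

/-! ### Minor monotonicity -/

theorem XiLE.of_iso {W V : Type*} [Fintype W] [Fintype V] {H : SimpleGraph W} {G : SimpleGraph V}
    (e : H ≃g G) : XiLE H G := by
  intro A hA hs
  obtain ⟨B, hB, hsB, hAB, -⟩ := exists_extension e.toEmbedding
    (fun i _ _ => e.surjective i) hA hs
  exact ⟨B, hB, hsB, hAB⟩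

theorem XiLE.induce {V : Type*} [Fintype V] (G : SimpleGraph V) (s : Set V) [Fintype s] :
    XiLE (G.induce s) G := by
  intro A hA hs
  -- `G` with all edges that leave `s` removed.
  let K : SimpleGraph V := (G.induce s).map (Function.Embedding.subtype _)
  have hKG : K ≤ G := by
    rintro i j ⟨-, u, v, h, rfl, rfl⟩
    exact h
  obtain ⟨B, hB, hsB, hAB, -⟩ := exists_extension
    (SimpleGraph.Embedding.map (Function.Embedding.subtype _) (G.induce s))
    (fun i j h => by obtain ⟨-, u, v, -, rfl, rfl⟩ := h; exact ⟨u, rfl⟩) hA hs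
  obtain ⟨D, hD, hsD, hBD⟩ := XiLE.of_le hKG B hB hsB
  exact ⟨D, hD, hsD, hAB.trans hBD⟩

theorem Constructible.xiLE {V : Type*} [Fintype V] {G : SimpleGraph V} {W : Type _}
    {K : SimpleGraph W} (h : Constructible G K) : Finite W ∧ ∀ [Fintype W], XiLE K G := by
  induction h with
  | refl =>
    have key : ∀ i₁ i₂ : Fintype V, @XiLE V V i₁ i₂ G G := fun i₁ i₂ => by
      obtain rfl := Subsingleton.elim i₁ i₂
      exact .of_iso .refl
    exact ⟨inferInstance, key _ _⟩
  | deleteEdge _ e _ ih =>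
    obtain ⟨hfin, ih⟩ := ih
    exact ⟨hfin, (XiLE.of_le (SimpleGraph.deleteEdges_le _)).trans ih⟩
  | @deleteVertex W K _ x ih =>
    obtain ⟨hfin, ih⟩ := ih
    have := Fintype.ofFinite W
    exact ⟨inferInstance, (XiLE.induce K _).trans ih⟩
  | @contractEdge W K _ a b hab ih =>
    obtain ⟨hfin, ih⟩ := ih
    have := Fintype.ofFinite W
    exact ⟨inferInstance, (XiLE.contract K hab).trans ih⟩

theorem IsMinor.xi_le {W V : Type*} [Fintype W] [Fintype V] {H : SimpleGraph W}
    {G : SimpleGraph V} (h : IsMinor H G) : xi H ≤ xi G := by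
  obtain ⟨U, K, hK, ⟨e⟩⟩ := h
  obtain ⟨hfin, hKG⟩ := hK.xiLE
  have := Fintype.ofFinite U
  exact ((XiLE.of_iso e.symm).trans hKG).xi_le

end ZeroForcing

theorem mainTheorem4 {V : Type*} {W : Type*} [Fintype V] [Fintype W]
    (G : SimpleGraph V) (H : SimpleGraph W)
    (hHG : ZeroForcing.IsZeroForcingMinor H G)
    (hH : ZeroForcing.xi H = ZeroForcing.zeroForcingNumber H) :
    ZeroForcing.xi G = ZeroForcing.maxNullity G ∧
      ZeroForcing.maxNullity G = ZeroForcing.zeroForcingNumber G ∧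
      ZeroForcing.zeroForcingNumber G = ZeroForcing.zeroForcingNumber H := by
  have h1 := hHG.1.xi_le
  have h2 := ZeroForcing.xi_le_maxNullity G
  have h3 := ZeroForcing.maxNullity_le_zeroForcingNumber G
  have h4 := hHG.2
  omega
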